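/- All graphs are finite and simple; $\mathrm d_\Gamma$ is the graph distance. A set $R$ of vertices of a connected graph $\Gamma$ is a *resolving set* if for any two distinct vertices $u,w$ there is $v\in R$ with $\mathrm d_\Gamma(u,v)\ne \mathrm d_\Gamma(w,v)$, and the *metric dimension* $\mu(\Gamma)$ is the smallest size of a resolving set. A connected graph $\Gamma$ is *distance-regular* if for all vertices $u,v$ with $\mathrm d_\Gamma(u,v)=i$, the numbers of neighbours of $v$ at distances $i-1$, $i$ and $i+1$ from $u$ depend only on $i$. The *distance-$i$ graph* of $\Gamma$ has the same vertices, two of them being adjacent iff they are at distance $i$ in $\Gamma$. A distance-regular graph of diameter $d$ is *primitive* if its distance-$i$ graph is connected for every $0<i\le d$. The *halved graphs* of a bipartite distance-regular graph are the (two) connected components of its distance-$2$ graph. Let $\Gamma$ be a bipartite distance-regular graph with $n$ vertices and diameter $d\ge 4$ whose halved graphs are primitive and have diameter at least $2$. Let $M(\Gamma)$ be the maximum, over all vertices $v$ and all $i$, of the number of vertices at distance $i$ from $v$, and let $\log$ be the natural logarithm. Then (i) $\displaystyle \mu(\Gamma) < 2\sqrt{2n}\,\log(n/2)$; (ii) $\displaystyle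 \mu(\Gamma) < d\,\frac{n}{n-2M(\Gamma)}\,\log(n/2)$. -/

import Mathlib

namespace SimpleGraph

variable {V : Type*}

/-- `R` is a resolving set for `G`: distinct vertices are told apart by their distances to
the members of `R`. -/
def IsResolvingSet (G : SimpleGraph V) (R : Finset V) : Prop :=
  ∀ u w : V, u ≠ w → ∃ v ∈ R, G.dist u v ≠ G.dist w v

/-- The metric dimension of `G` is the smallest size of a resolving set. (In a finite connected
graph the set of all vertices is resolving, so this is the minimum of a nonempty set.) -/
noncomputable def metricDim (G : SimpleGraph V) : ℕ :=
  sInf {m : ℕ | ∃ R : Finset V, G.IsResolvingSet R ∧ R.card = m}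

/-- `G` is distance-regular: it is connected and, for vertices `u`, `v` at distance `i`, the
number of neighbours of `v` at distance `j` from `u` depends only on `i`, for every `j`
(only `j = i - 1`, `i`, `i + 1` matter, since for other `j` there are no such neighbours). -/
def IsDistanceRegular (G : SimpleGraph V) : Prop :=
  G.Connected ∧ ∀ u v u' v' : V, G.dist u v = G.dist u' v' → ∀ j : ℕ,
    {w : V | G.Adj v w ∧ G.dist u w = j}.ncard = {w : V | G.Adj v' w ∧ G.dist u' w = j}.ncard

/-- The distance-`i` graph of `G`: two distinct vertices are adjacent iff they are at
distance `i` in `G`. -/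
def distanceGraph (G : SimpleGraph V) (i : ℕ) : SimpleGraph V where
  Adj u v := u ≠ v ∧ G.dist u v = i
  symm := ⟨fun _ _ h => ⟨h.1.symm, G.dist_comm ▸ h.2⟩⟩
  loopless := ⟨fun _ h => h.1 rfl⟩

/-- Primitivity of a (distance-regular) graph of diameter `d`: for each `0 < i ≤ d` the
distance-`i` graph is connected. -/
def IsPrimitive (G : SimpleGraph V) : Prop :=
  ∀ i : ℕ, 0 < i → i ≤ G.diam → (G.distanceGraph i).Connected

/-- The halved graphs of `G` are the connected components of its distance-`2` graph. -/
abbrev HalvedIndex (G : SimpleGraph V) : Type _ :=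
  (G.distanceGraph 2).ConnectedComponent

/-- The halved graph given by a connected component `C` of the distance-`2` graph: the graph
induced on `C` by the distance-`2` graph. -/
abbrev halvedGraph (G : SimpleGraph V) (C : G.HalvedIndex) : SimpleGraph C.supp :=
  (G.distanceGraph 2).induce C.supp

/-- The maximum size of a set of vertices at a given distance from a vertex of `G`. -/
noncomputable def maxSphereCard [Fintype V] (G : SimpleGraph V) : ℕ :=
  Finset.univ.sup fun v : V =>
    (Finset.range (G.diam + 1)).sup fun i : ℕ => {w : V | G.dist v w = i}.ncard

end SimpleGraph

open scoped Finset

/-! ### Resolvers in symmetric schemes, and counting along connected colour graphs -/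

section Schemes

open scoped Classical

variable {X Z : Type*} [Fintype Z]

/-! Any single vertex resolves a pair from different halves, by parity. So only pairs inside one
half matter. If each of these is resolved by a proportion `x` of all vertices, a greedy choice of
fewer than `2 log N / x` vertices resolves them all, where `N = n / 2` is the size of a half
(`metricDim_lt_of_resolvers`). Both bounds therefore reduce to lower bounds on the number `γ` of
resolvers of a same-half pair.

The distances of `G` restricted to a half form a symmetric scheme, and primitivity of the halved
graph says that every nontrivial colour graph is connected. Since `γ` depends only on the colour,
and resolvers obey a triangle inequality along walks, one pair with few resolvers limits the
resolvers of all pairs.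

For (ii), walks in a colour graph need at most `⌊d/2⌋` steps, because a geodesic meets a new colour
at each step. Averaging the resolvers of `u₀, w` over `w` then gives `γ ≥ 4 (N - M) / d`
(`card_mul_le_card_resolvers`).

For (i), `N ≤ γ ^ 2` (`card_le_card_resolvers_sq`). If the valency `κ` of the colour is below `2γ`,
this follows from `2 (N - 1) ≤ κ γ`, got by counting the edges whose ends are at different distances
from a point. Otherwise, fewer than `γ` points lie outside the closed neighbourhood of a point, and
each neighbour is reached through two pairs of other colours, so `κ` is at most the square of the
number of those points. -/

/-- The points `z` at which the functions `f u` and `f w` differ. -/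
noncomputable def resolvers (f : X → Z → ℕ) (u w : X) : Finset Z := {z | f u z ≠ f w z}

theorem mem_resolvers {f : X → Z → ℕ} {u w : X} {z : Z} :
    z ∈ resolvers f u w ↔ f u z ≠ f w z := by simp [resolvers]

theorem resolvers_self (f : X → Z → ℕ) (u : X) : resolvers f u u = ∅ := by
  ext z; simp [mem_resolvers]

theorem card_resolvers_triangle (f : X → Z → ℕ) (u v w : X) :
    #(resolvers f u w) ≤ #(resolvers f u v) + #(resolvers f v w) := by
  refine (Finset.card_le_card ?_).trans (Finset.card_union_le _ _)
  intro z hz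
  rw [Finset.mem_union, mem_resolvers, mem_resolvers]
  rw [mem_resolvers] at hz
  by_contra! h
  exact hz (h.1.trans h.2)

/-- The graph formed by the pairs of colour `a`. -/
def colorGraph (c : X → X → ℕ) (hc : ∀ u w, c u w = c w u) (a : ℕ) : SimpleGraph X where
  Adj u w := u ≠ w ∧ c u w = a
  symm := ⟨fun u w h => ⟨h.1.symm, hc u w ▸ h.2⟩⟩
  loopless := ⟨fun _ h => h.1 rfl⟩

theorem card_resolvers_le_length (f : X → Z → ℕ) {H : SimpleGraph X} {m : ℕ}
    (hm : ∀ u w, H.Adj u w → #(resolvers f u w) ≤ m) {u w : X} (p : H.Walk u w) :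
    #(resolvers f u w) ≤ p.length * m := by
  induction p with
  | nil => simp [resolvers_self]
  | cons h p ih =>
    refine (card_resolvers_triangle f _ _ _).trans ((add_le_add (hm _ _ h) ih).trans ?_)
    rw [SimpleGraph.Walk.length_cons]
    exact le_of_eq (by ring)

/-- A symmetric association scheme on `X`, given by the colouring `c` of the pairs, with
colour `0` for the diagonal. -/
structure IsSymmScheme [Fintype X] (c : X → X → ℕ) : Prop where
  symm : ∀ u w, c u w = c w u
  eq_zero_iff : ∀ u w, c u w = 0 ↔ u = w
  card_eq : ∀ u w u' w', c u w = c u' w' → ∀ i j,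
    #{v | c u v = i ∧ c w v = j} = #{v | c u' v = i ∧ c w' v = j}

namespace IsSymmScheme

variable [Fintype X] {c : X → X → ℕ}

theorem exists_of_color_eq (hc : IsSymmScheme c) {u w u' w' : X} (h : c u w = c u' w') (v : X) :
    ∃ v', c u' v' = c u v ∧ c w' v' = c w v := by
  have h1 := hc.card_eq u w u' w' h (c u v) (c w v)
  have h2 : 0 < #{x | c u x = c u v ∧ c w x = c w v} :=
    Finset.card_pos.2 ⟨v, by simp⟩
  rw [h1] at h2
  obtain ⟨v', hv'⟩ := Finset.card_pos.1 h2
  exact ⟨v', by simpa using hv'⟩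

theorem adj_iff (hc : IsSymmScheme c) {a : ℕ} (ha : a ≠ 0) {u w : X} :
    (colorGraph c hc.symm a).Adj u w ↔ c u w = a :=
  ⟨fun h => h.2, fun h => ⟨fun e => ha (h ▸ (hc.eq_zero_iff u w).2 e), h⟩⟩

/-- Equal intersection numbers let a walk be copied one vertex at a time. Hence distance in a colour
graph is a function of the colour. -/
theorem exists_walk_of_color_eq (hc : IsSymmScheme c) (a : ℕ) (s : ℕ) : ∀ {u w u' w' : X},
    c u w = c u' w' → (∃ p : (colorGraph c hc.symm a).Walk u w, p.length = s) →
    ∃ p : (colorGraph c hc.symm a).Walk u' w', p.length = s := by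
  induction s with
  | zero =>
    rintro u w u' w' h ⟨p, hp⟩
    have := SimpleGraph.Walk.eq_of_length_eq_zero hp
    rw [(hc.eq_zero_iff u w).2 this] at h
    obtain rfl := (hc.eq_zero_iff u' w').1 h.symm
    exact ⟨.nil, rfl⟩
  | succ s ih =>
    rintro u w u' w' h ⟨p, hp⟩
    cases p with
    | nil => simp at hp
    | @cons _ v _ hv p =>
      obtain ⟨v', h1, h2⟩ := hc.exists_of_color_eq h v
      obtain ⟨q, hq⟩ := ih (u := v) (w := w) (u' := v') (w' := w')
        (by rw [hc.symm v w, hc.symm v' w', h2])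
        ⟨p, by simpa using hp⟩
      have hadj : (colorGraph c hc.symm a).Adj u' v' := by
        refine ⟨fun e => hv.1 ?_, h1.trans hv.2⟩
        rw [← hc.eq_zero_iff, ← h1, hc.eq_zero_iff]
        exact e
      exact ⟨.cons hadj q, by simp [hq]⟩

theorem dist_le_of_color_eq (hc : IsSymmScheme c) {a : ℕ}
    (hconn : (colorGraph c hc.symm a).Connected) {u w u' w' : X} (h : c u w = c u' w') :
    (colorGraph c hc.symm a).dist u' w' ≤ (colorGraph c hc.symm a).dist u w := by
  obtain ⟨p, hp⟩ := hconn.exists_walk_length_eq_dist u w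
  obtain ⟨q, hq⟩ := hc.exists_walk_of_color_eq a _ h ⟨p, hp⟩
  exact hq ▸ SimpleGraph.dist_le q

theorem dist_eq_of_color_eq (hc : IsSymmScheme c) {a : ℕ}
    (hconn : (colorGraph c hc.symm a).Connected) {u w u' w' : X} (h : c u w = c u' w') :
    (colorGraph c hc.symm a).dist u w = (colorGraph c hc.symm a).dist u' w' :=
  le_antisymm (hc.dist_le_of_color_eq hconn h.symm) (hc.dist_le_of_color_eq hconn h)

theorem card_color_eq (hc : IsSymmScheme c) (u u' : X) (a : ℕ) :
    #{v | c u v = a} = #{v | c u' v = a} := by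
  have := hc.card_eq u u u' u' (by rw [(hc.eq_zero_iff u u).2 rfl, (hc.eq_zero_iff u' u').2 rfl]) a a
  simpa using this

/-- The points that fail to resolve a pair are counted by the diagonal intersection numbers, those
with both colours equal. -/
theorem card_resolvers_eq (hc : IsSymmScheme c) {u w u' w' : X} (h : c u w = c u' w') :
    #(resolvers c u w) = #(resolvers c u' w') := by
  have key : ∀ u w : X, #(resolvers c u w) + ∑ i ∈ Finset.univ.image (Function.uncurry c),
      #{v | c u v = i ∧ c w v = i} = Fintype.card X := by
    intro u w
    have h1 := Finset.card_filter_add_card_filter_not (s := (Finset.univ : Finset X))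
      (fun v => c u v ≠ c w v)
    rw [Finset.card_univ] at h1
    rw [← h1]
    congr 1
    rw [Finset.card_eq_sum_card_fiberwise (f := fun v => c u v)
      (t := Finset.univ.image (Function.uncurry c))]
    · refine Finset.sum_congr rfl fun i _ => ?_
      congr 1
      ext v
      simp only [Finset.mem_filter, Finset.mem_univ, true_and, not_not]
      constructor
      · rintro ⟨h1, h2⟩
        exact ⟨by rw [h1, h2], h1⟩
      · rintro ⟨h1, h2⟩
        exact ⟨h2, by rw [← h1, h2]⟩
    · intro v _
      exact Finset.mem_coe.2 (Finset.mem_image.2 ⟨(u, v), Finset.mem_univ _, rfl⟩)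
  have h1 := key u w
  rw [Finset.sum_congr rfl fun i _ => hc.card_eq u w u' w' h i i] at h1
  have h2 := key u' w'
  omega

/-- A geodesic in a connected colour graph uses a new colour at each step. -/
theorem dist_le_card_colors (hc : IsSymmScheme c) {a : ℕ}
    (hconn : (colorGraph c hc.symm a).Connected) {S : Finset ℕ}
    (hS : ∀ u w, u ≠ w → c u w ∈ S) (u w : X) :
    (colorGraph c hc.symm a).dist u w ≤ #S := by
  obtain ⟨p, hp⟩ := hconn.exists_walk_length_eq_dist u w
  have hd : ∀ s ≤ p.length, (colorGraph c hc.symm a).dist u (p.getVert s) = s := by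
    intro s hs
    have h1 : (colorGraph c hc.symm a).dist u (p.getVert s) ≤ s := by
      refine (SimpleGraph.dist_le (p.take s)).trans ?_
      simp
    have h2 : (colorGraph c hc.symm a).dist (p.getVert s) w ≤ p.length - s := by
      refine (SimpleGraph.dist_le (p.drop s)).trans ?_
      simp
    have h3 := hconn.dist_triangle (u := u) (v := p.getVert s) (w := w)
    omega
  rw [← hp]
  -- The vertices of the geodesic lie at different distances from `u`, hence have different colours.
  -- The start is omitted since `S` need not contain the diagonal colour.
  have : #(Finset.Icc 1 p.length) ≤ #S := by
    refine Finset.card_le_card_of_injOn (fun s => c u (p.getVert s)) ?_ ?_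
    · intro s hs
      simp only [Finset.coe_Icc, Set.mem_Icc] at hs
      refine hS _ _ fun e => ?_
      have := hd s hs.2
      rw [← e, SimpleGraph.dist_self] at this
      omega
    · intro s hs t ht hst
      simp only [Finset.coe_Icc, Set.mem_Icc] at hs ht
      rw [← hd s hs.2, ← hd t ht.2]
      exact hc.dist_eq_of_color_eq hconn hst
  simpa using this

/-- Lower bound for the number of resolvers of a pair whose colour graph is connected, in terms
of the number of colours and the largest fibre of the functions `f · z`. -/
theorem card_mul_le_card_resolvers (hc : IsSymmScheme c) (f : X → Z → ℕ)
    (hf : ∀ u w u' w', c u w = c u' w' → #(resolvers f u w) = #(resolvers f u' w'))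
    {M : ℕ} (hM : ∀ z i, #{u | f u z = i} ≤ M) {S : Finset ℕ} (hS : ∀ u w, u ≠ w → c u w ∈ S)
    {u₀ w₀ : X} (hconn : (colorGraph c hc.symm (c u₀ w₀)).Connected) :
    Fintype.card Z * (Fintype.card X - M) ≤
      Fintype.card X * (#S * #(resolvers f u₀ w₀)) := by
  have h1 : ∀ w, #(resolvers f u₀ w) ≤ #S * #(resolvers f u₀ w₀) := by
    intro w
    obtain ⟨p, hp⟩ := hconn.exists_walk_length_eq_dist u₀ w
    refine (card_resolvers_le_length f (m := #(resolvers f u₀ w₀))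
      (fun u w (h : u ≠ w ∧ c u w = c u₀ w₀) => (hf _ _ _ _ h.2).le) p).trans ?_
    exact Nat.mul_le_mul_right _ (hp ▸ hc.dist_le_card_colors hconn hS u₀ w)
  have h2 : ∑ w : X, #(resolvers f u₀ w) = ∑ z : Z, #{w | f u₀ z ≠ f w z} :=
    Finset.sum_card_bipartiteAbove_eq_sum_card_bipartiteBelow (fun w z => f u₀ z ≠ f w z)
  have h3 : ∀ z : Z, Fintype.card X - M ≤ #{w | f u₀ z ≠ f w z} := by
    intro z
    have h4 := Finset.card_filter_add_card_filter_not (s := (Finset.univ : Finset X))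
      (fun w => f w z = f u₀ z)
    rw [Finset.card_univ] at h4
    have h5 := hM z (f u₀ z)
    simp only [ne_eq, eq_comm (a := f u₀ z)]
    omega
  calc Fintype.card Z * (Fintype.card X - M)
      = ∑ _z : Z, (Fintype.card X - M) := by simp
    _ ≤ ∑ z : Z, #{w | f u₀ z ≠ f w z} := Finset.sum_le_sum fun z _ => h3 z
    _ = ∑ w : X, #(resolvers f u₀ w) := h2.symm
    _ ≤ ∑ _w : X, #S * #(resolvers f u₀ w₀) := Finset.sum_le_sum fun w _ => h1 w
    _ = _ := by simp

/-- The valency of a colour graph times the number of resolvers of an edge is large, because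
each vertex has a neighbour closer to any other given vertex. -/
theorem two_mul_card_le_valency_mul (hc : IsSymmScheme c) {u₀ w₀ : X} (h₀ : u₀ ≠ w₀)
    (hconn : (colorGraph c hc.symm (c u₀ w₀)).Connected) :
    2 * (Fintype.card X - 1) ≤ #{v | c u₀ v = c u₀ w₀} * #(resolvers c u₀ w₀) := by
  set a := c u₀ w₀ with ha
  set H := colorGraph c hc.symm a with hH
  have ha0 : a ≠ 0 := fun e => h₀ ((hc.eq_zero_iff _ _).1 (ha ▸ e))
  have hadj : ∀ {u w}, H.Adj u w ↔ c u w = a := fun {u w} => hc.adj_iff ha0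
  -- `T` counts the triples `(u, w, v)` with `w` a neighbour of `u` closer to `v`
  have hlow : ∀ v u : X, (if u = v then 0 else 1) ≤
      ∑ w with c u w = a, if H.dist w v < H.dist u v then 1 else 0 := by
    intro v u
    split_ifs with huv
    · exact Nat.zero_le _
    · obtain ⟨p, hp⟩ := hconn.exists_walk_length_eq_dist u v
      cases p with
      | nil => exact absurd rfl huv
      | @cons _ x _ hx p =>
        have h1 := SimpleGraph.dist_le p
        rw [SimpleGraph.Walk.length_cons] at hp
        have h2 : H.dist x v < H.dist u v := by omega
        calc 1 = if H.dist x v < H.dist u v then 1 else 0 := by rw [if_pos h2]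
          _ ≤ _ := Finset.single_le_sum
            (f := fun w => if H.dist w v < H.dist u v then 1 else 0) (fun _ _ => Nat.zero_le _)
            (by simpa using hadj.1 hx)
  have hT : Fintype.card X * (Fintype.card X - 1) ≤
      ∑ u, ∑ w with c u w = a, #{v | H.dist w v < H.dist u v} := by
    calc Fintype.card X * (Fintype.card X - 1)
        = ∑ v : X, ∑ u : X, (if u = v then 0 else 1) := by
          have : ∀ v : X, ∑ u : X, (if u = v then 0 else 1) = Fintype.card X - 1 := by
            intro v
            have h := Finset.card_erase_of_mem (Finset.mem_univ v)
            rw [Finset.card_univ] at h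
            rw [← h, Finset.card_eq_sum_ones, ← Finset.filter_ne', Finset.sum_filter]
            exact Finset.sum_congr rfl fun u _ => by by_cases e : u = v <;> simp [e]
          rw [Finset.sum_congr rfl fun v _ => this v]
          simp
      _ ≤ ∑ v : X, ∑ u : X, ∑ w with c u w = a, if H.dist w v < H.dist u v then 1 else 0 :=
          Finset.sum_le_sum fun v _ => Finset.sum_le_sum fun u _ => hlow v u
      _ = _ := by
          rw [Finset.sum_comm]
          refine Finset.sum_congr rfl fun u _ => ?_
          rw [Finset.sum_comm]
          exact Finset.sum_congr rfl fun w _ => by rw [Finset.card_filter]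
  -- Reversing each edge exchanges the closer and the farther end.
  have hswap : ∑ u, ∑ w with c u w = a, #{v | H.dist w v < H.dist u v} =
      ∑ u, ∑ w with c u w = a, #{v | H.dist u v < H.dist w v} := by
    simp only [Finset.sum_filter]
    rw [Finset.sum_comm]
    exact Finset.sum_congr rfl fun u _ => Finset.sum_congr rfl fun w _ => by rw [hc.symm]
  have hup : ∀ u w, c u w = a → #{v | H.dist w v < H.dist u v} + #{v | H.dist u v < H.dist w v} ≤
      #(resolvers c u₀ w₀) := by
    intro u w huw
    rw [← hc.card_resolvers_eq (huw.trans ha), ← Finset.card_union_of_disjoint]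
    · refine Finset.card_le_card fun v hv => ?_
      rw [mem_resolvers]
      intro e
      have hd := hc.dist_eq_of_color_eq hconn e
      simp only [Finset.mem_union, Finset.mem_filter, Finset.mem_univ, true_and] at hv
      simp only [← hH] at hd
      omega
    · rw [Finset.disjoint_left]
      intro v hv hv'
      simp only [Finset.mem_filter, Finset.mem_univ, true_and] at hv hv'
      omega
  have hfin : Fintype.card X * (2 * (Fintype.card X - 1)) ≤
      Fintype.card X * (#{v | c u₀ v = a} * #(resolvers c u₀ w₀)) := by
    calc Fintype.card X * (2 * (Fintype.card X - 1))
        = Fintype.card X * (Fintype.card X - 1) + Fintype.card X * (Fintype.card X - 1) := by ring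
      _ ≤ (∑ u, ∑ w with c u w = a, #{v | H.dist w v < H.dist u v}) +
          ∑ u, ∑ w with c u w = a, #{v | H.dist u v < H.dist w v} :=
          add_le_add hT (hswap ▸ hT)
      _ = ∑ u, ∑ w with c u w = a,
          (#{v | H.dist w v < H.dist u v} + #{v | H.dist u v < H.dist w v}) := by
          simp only [Finset.sum_add_distrib]
      _ ≤ ∑ u, ∑ w with c u w = a, #(resolvers c u₀ w₀) :=
          Finset.sum_le_sum fun u _ => Finset.sum_le_sum fun w hw =>
            hup u w (by simpa using hw)
      _ = ∑ _u : X, #{v | c u₀ v = a} * #(resolvers c u₀ w₀) := by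
          refine Finset.sum_congr rfl fun u _ => ?_
          rw [Finset.sum_const, smul_eq_mul, hc.card_color_eq u u₀]
      _ = _ := by simp
  exact Nat.le_of_mul_le_mul_left hfin (Fintype.card_pos_iff.2 ⟨u₀⟩)

/-- The symmetric difference of the two `a`-neighbourhoods consists of resolvers, and its two parts
are equally large because the valency is constant. -/
theorem two_mul_card_sdiff_le (hc : IsSymmScheme c) (a : ℕ) (u w : X) :
    2 * #{v | c w v = a ∧ c u v ≠ a} ≤ #(resolvers c u w) := by
  have h1 := Finset.card_filter_add_card_filter_not (s := ({v | c u v = a} : Finset X))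
    (fun v => c w v = a)
  have h2 := Finset.card_filter_add_card_filter_not (s := ({v | c w v = a} : Finset X))
    (fun v => c u v = a)
  simp only [Finset.filter_filter] at h1 h2
  have h3 : #{v | c u v = a ∧ c w v = a} = #{v | c w v = a ∧ c u v = a} := by
    simp only [and_comm]
  rw [hc.card_color_eq u w] at h1
  have h4 : #{v | c u v = a ∧ ¬ c w v = a} + #{v | c w v = a ∧ ¬ c u v = a} ≤
      #(resolvers c u w) := by
    rw [← Finset.card_union_of_disjoint]
    · refine Finset.card_le_card fun v hv => ?_
      rw [mem_resolvers]
      intro e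
      simp only [Finset.mem_union, Finset.mem_filter, Finset.mem_univ, true_and, e] at hv
      tauto
    · rw [Finset.disjoint_left]
      intro v hv hv'
      simp only [Finset.mem_filter, Finset.mem_univ, true_and] at hv hv'
      tauto
  simp only [ne_eq]
  omega

theorem card_common_add_card_sdiff (hc : IsSymmScheme c) (a : ℕ) (u w : X) :
    #{v | c w v = a ∧ c u v = a} + #{v | c w v = a ∧ c u v ≠ a} = #{v | c u v = a} := by
  have h2 := Finset.card_filter_add_card_filter_not (s := ({v | c w v = a} : Finset X))
    (fun v => c u v = a)
  simp only [Finset.filter_filter] at h2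
  rw [← hc.card_color_eq w u]
  exact h2

end IsSymmScheme

end Schemes

/-! ### The square bound for primitive schemes -/

section Schemes

open scoped Classical

variable {X : Type*} [Fintype X] {c : X → X → ℕ}

namespace IsSymmScheme

/-- If the colour graph of `u₀, w₀` has large valency compared with the number of resolvers of
`u₀, w₀`, then there are few pairs of other colours. -/
theorem card_compl_add_two_le (hc : IsSymmScheme c) {u₀ w₀ : X} (h₀ : u₀ ≠ w₀)
    (hconn : (colorGraph c hc.symm (c u₀ w₀)).Connected)
    (hval : 2 * #(resolvers c u₀ w₀) ≤ #{v | c u₀ v = c u₀ w₀}) :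
    #{v | v ≠ u₀ ∧ c u₀ v ≠ c u₀ w₀} + 2 ≤ #(resolvers c u₀ w₀) := by
  set a := c u₀ w₀ with ha
  set γ := #(resolvers c u₀ w₀) with hγ
  set κ := #{v | c u₀ v = a} with hκ
  have ha0 : a ≠ 0 := fun e => h₀ ((hc.eq_zero_iff _ _).1 (ha ▸ e))
  have hγ0 : 2 ≤ γ := by
    have h1 : ({u₀, w₀} : Finset X) ⊆ resolvers c u₀ w₀ := by
      intro v hv
      rw [mem_resolvers]
      simp only [Finset.mem_insert, Finset.mem_singleton] at hv
      rcases hv with rfl | rfl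
      · rw [hc.symm w₀, (hc.eq_zero_iff _ _).2 rfl]; exact ha0.symm
      · rw [(hc.eq_zero_iff v v).2 rfl]; exact ha0
    have := Finset.card_le_card h1
    rwa [Finset.card_pair h₀] at this
  have hedge : ∀ u w, c u w = a → #(resolvers c u w) = γ := fun u w h =>
    hc.card_resolvers_eq (h.trans ha)
  have hval' : ∀ u, #{v | c u v = a} = κ := fun u => hc.card_color_eq u u₀ a
  -- any two vertices have a common neighbour
  have hcommon : ∀ v, ∃ x, c v x = a ∧ c u₀ x = a := by
    have of_le : ∀ v, #(resolvers c u₀ v) ≤ 3 * γ → ∃ x, c v x = a ∧ c u₀ x = a := by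
      intro v hv
      have h1 := hc.card_common_add_card_sdiff a u₀ v
      have h2 := hc.two_mul_card_sdiff_le a u₀ v
      rw [hval'] at h1
      have h3 : 0 < #{x | c v x = a ∧ c u₀ x = a} := by omega
      obtain ⟨x, hx⟩ := Finset.card_pos.1 h3
      exact ⟨x, by simpa using hx⟩
    have walk : ∀ (v w : X) (p : (colorGraph c hc.symm a).Walk v w),
        (∃ x, c v x = a ∧ c u₀ x = a) → ∃ x, c w x = a ∧ c u₀ x = a := by
      intro v w p
      induction p with
      | nil => exact id
      | @cons v x _ h p ih =>
        -- The path `u₀, y, v, x` has three edges, so `u₀, x` has at most `3γ` resolvers. At least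
        -- `κ - 3γ/2 > 0` common neighbours remain.
        rintro ⟨y, h1, h2⟩
        refine ih (of_le x ?_)
        have h3 := card_resolvers_triangle c u₀ y x
        have h4 := card_resolvers_triangle c y v x
        rw [hedge u₀ y h2] at h3
        rw [hedge y v ((hc.symm _ _).trans h1), hedge v x h.2] at h4
        omega
    intro v
    obtain ⟨p⟩ := hconn.preconnected u₀ v
    exact walk _ _ p ⟨w₀, rfl, rfl⟩
  have hup : ∀ w, c u₀ w = a → 2 * #{z | (z ≠ u₀ ∧ c u₀ z ≠ a) ∧ c w z = a} + 2 ≤ γ := by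
    intro w hw
    have h1 := hc.two_mul_card_sdiff_le a u₀ w
    rw [hedge u₀ w hw] at h1
    -- Counting `u₀` itself in the difference produces the summand `2`.
    have h2 : insert u₀ ({z | (z ≠ u₀ ∧ c u₀ z ≠ a) ∧ c w z = a} : Finset X) ⊆
        ({v | c w v = a ∧ c u₀ v ≠ a} : Finset X) := by
      intro z hz
      simp only [Finset.mem_insert, Finset.mem_filter, Finset.mem_univ, true_and] at hz ⊢
      rcases hz with rfl | hz
      · exact ⟨(hc.symm _ _).trans hw, by rw [(hc.eq_zero_iff z z).2 rfl]; exact ha0.symm⟩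
      · exact ⟨hz.2, hz.1.2⟩
    have h3 := Finset.card_le_card h2
    rw [Finset.card_insert_of_notMem (by simp)] at h3
    omega
  -- With a common neighbour always available, every pair with `u₀` has at most `2γ` resolvers.
  have hlow : ∀ z, κ ≤ #{w | c u₀ w = a ∧ c w z = a} + γ := by
    intro z
    obtain ⟨x, h1, h2⟩ := hcommon z
    have h3 := card_resolvers_triangle c u₀ x z
    rw [hedge u₀ x h2, hedge x z ((hc.symm _ _).trans h1)] at h3
    have h4 := hc.card_common_add_card_sdiff a u₀ z
    have h5 := hc.two_mul_card_sdiff_le a u₀ z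
    rw [hval'] at h4
    have h6 : #{w | c u₀ w = a ∧ c w z = a} = #{v | c z v = a ∧ c u₀ v = a} := by
      congr 1
      ext w
      simp only [Finset.mem_filter, Finset.mem_univ, true_and, hc.symm w z, and_comm]
    omega
  set C : Finset X := {v | v ≠ u₀ ∧ c u₀ v ≠ a} with hC
  have hdouble : ∑ w with c u₀ w = a, #{z ∈ C | c w z = a} =
      ∑ z ∈ C, #{w ∈ ({w | c u₀ w = a} : Finset X) | c w z = a} :=
    Finset.sum_card_bipartiteAbove_eq_sum_card_bipartiteBelow (fun w z => c w z = a)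
  have h1 : ∑ w with c u₀ w = a, (2 * #{z ∈ C | c w z = a} + 2) ≤ κ * γ := by
    refine (Finset.sum_le_card_nsmul _ _ γ fun w hw => ?_).trans_eq (smul_eq_mul _ _)
    have := hup w (by simpa using hw)
    rwa [hC, Finset.filter_filter]
  have h2 : #C * κ ≤ ∑ z ∈ C, (#{w ∈ ({w | c u₀ w = a} : Finset X) | c w z = a} + γ) := by
    rw [← smul_eq_mul]
    refine Finset.card_nsmul_le_sum _ _ _ fun z _ => ?_
    have := hlow z
    rwa [Finset.filter_filter]
  rw [Finset.sum_add_distrib, ← Finset.mul_sum, hdouble, Finset.sum_const, smul_eq_mul] at h1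
  rw [Finset.sum_add_distrib, Finset.sum_const, smul_eq_mul] at h2
  rw [← hκ] at h1
  obtain ⟨e, he⟩ := Nat.exists_eq_add_of_le hval
  obtain ⟨g, hg⟩ := Nat.exists_eq_add_of_le hγ0
  -- `2 ρ (κ - γ) ≤ κ (γ - 2)` and `κ ≤ 2 (κ - γ)`
  rw [he] at h1 h2
  by_contra! hlt
  rw [hg] at h1 h2 hlt
  have h5 : g + 1 ≤ #C := by omega
  nlinarith [Nat.mul_le_mul_right e h5, Nat.mul_le_mul_right g h5, h5]

/-- In a primitive symmetric scheme with at least two nontrivial colours, the number of points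
is at most the square of the number of resolvers of any pair. -/
theorem card_le_card_resolvers_sq (hc : IsSymmScheme c)
    (hprim : ∀ u w, u ≠ w → (colorGraph c hc.symm (c u w)).Connected)
    {u₀ w₀ : X} (h₀ : u₀ ≠ w₀) (hrank : ∃ u w, u ≠ w ∧ c u w ≠ c u₀ w₀) :
    Fintype.card X ≤ #(resolvers c u₀ w₀) ^ 2 := by
  have hX : 0 < Fintype.card X := Fintype.card_pos_iff.2 ⟨u₀⟩
  rcases lt_or_ge #{v | c u₀ v = c u₀ w₀} (2 * #(resolvers c u₀ w₀)) with hlt | hge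
  · have h1 := hc.two_mul_card_le_valency_mul h₀ (hprim _ _ h₀)
    have hpos : 0 < #(resolvers c u₀ w₀) := by omega
    have h2 : 2 * (Fintype.card X - 1) < 2 * #(resolvers c u₀ w₀) * #(resolvers c u₀ w₀) :=
      lt_of_le_of_lt h1 (Nat.mul_lt_mul_of_pos_right hlt hpos)
    have h3 : 2 * #(resolvers c u₀ w₀) * #(resolvers c u₀ w₀) =
      2 * #(resolvers c u₀ w₀) ^ 2 := by ring
    omega
  · have h1 := hc.card_compl_add_two_le h₀ (hprim _ _ h₀) hge
    set a := c u₀ w₀ with ha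
    have ha0 : a ≠ 0 := fun e => h₀ ((hc.eq_zero_iff _ _).1 (ha ▸ e))
    set C : Finset X := {v | v ≠ u₀ ∧ c u₀ v ≠ a} with hC
    -- some, hence every, pair of colour `a` is joined by two pairs of other colours
    have hjoin : ∃ u v w, c u v ≠ a ∧ c v w ≠ a ∧ c u w = a := by
      by_contra! hno
      obtain ⟨x, y, hxy, hne⟩ := hrank
      have walk : ∀ (v w : X) (p : (colorGraph c hc.symm (c x y)).Walk v w), c v w ≠ a := by
        intro v w p
        induction p with
        | nil => rw [(hc.eq_zero_iff _ _).2 rfl]; exact ha0.symm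
        | cons h p ih => exact hno _ _ _ (by rw [h.2]; exact hne) ih
      obtain ⟨p⟩ := (hprim x y hxy).preconnected u₀ w₀
      exact walk _ _ p rfl
    -- Each neighbour of `u₀` is reached through some `v` in `C`, and each such `v` has only `#C`
    -- vertices other than itself at a colour different from `a`.
    have hcard : #{v | c u₀ v = a} ≤ #C * #C := by
      have hsub : ({w | c u₀ w = a} : Finset X) ⊆
          C.biUnion fun v => ({w | w ≠ v ∧ c v w ≠ a} : Finset X) := by
        intro w hw
        simp only [Finset.mem_filter, Finset.mem_univ, true_and] at hw
        obtain ⟨u, v, z, h2, h3, h4⟩ := hjoin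
        obtain ⟨v', h5, h6⟩ := hc.exists_of_color_eq (h4.trans hw.symm) v
        rw [← h5] at h2
        rw [hc.symm, ← h6, hc.symm] at h3
        rw [Finset.mem_biUnion]
        refine ⟨v', ?_, ?_⟩
        · simp only [hC, Finset.mem_filter, Finset.mem_univ, true_and]
          exact ⟨fun e => h3 (e ▸ hw), h2⟩
        · simp only [Finset.mem_filter, Finset.mem_univ, true_and]
          exact ⟨fun e => h2 (e ▸ hw), h3⟩
      refine (Finset.card_le_card hsub).trans (Finset.card_biUnion_le_card_mul _ _ _ ?_)
      have hall : ∀ v, #{w | w ≠ v ∧ c v w ≠ a} + #{w | c v w = a} + 1 = Fintype.card X := by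
        intro v
        have h2 := Finset.card_filter_add_card_filter_not (s := (Finset.univ : Finset X))
          (fun w => c v w ≠ a)
        have h3 : (Finset.univ.filter fun w => c v w ≠ a) = insert v ({w | w ≠ v ∧ c v w ≠ a} : Finset X) := by
          ext w
          simp only [Finset.mem_insert, Finset.mem_filter, Finset.mem_univ, true_and]
          constructor
          · exact fun h => (em (w = v)).imp_right fun e => ⟨e, h⟩
          · rintro (rfl | h)
            · rw [(hc.eq_zero_iff w w).2 rfl]; exact ha0.symm
            · exact h.2
        rw [h3, Finset.card_insert_of_notMem (by simp), Finset.card_univ] at h2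
        simp only [not_not] at h2
        omega
      intro v _
      have h2 := hall v
      have h3 : #C + #{w | c u₀ w = a} + 1 = Fintype.card X := hall u₀
      have h4 := hc.card_color_eq v u₀ a
      omega
    have hcover : Fintype.card X ≤ 1 + #{v | c u₀ v = a} + #C := by
      rw [← Finset.card_univ, ← Finset.card_singleton u₀]
      refine (Finset.card_le_card (t := {u₀} ∪ ({v | c u₀ v = a} : Finset X) ∪ C) ?_).trans
        ((Finset.card_union_le _ _).trans (Nat.add_le_add_right (Finset.card_union_le _ _) _))
      intro v _
      simp only [hC, Finset.mem_union, Finset.mem_singleton, Finset.mem_filter, Finset.mem_univ,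
        true_and]
      tauto
    -- With `ρ = #C`, the count is `1 + ρ ^ 2 + ρ ≤ (ρ + 2) ^ 2`.
    nlinarith [Nat.pow_le_pow_left h1 2]

end IsSymmScheme

end Schemes

/-! ### Distance-regular graphs give symmetric schemes -/

section DistanceRegular

open scoped Classical

variable {V : Type*} {G : SimpleGraph V}

namespace SimpleGraph

theorem exists_dist_factor {α : Type*} [Inhabited α] (G : SimpleGraph V) (q : V → V → α)
    (hq : ∀ u w u' w', G.dist u w = G.dist u' w' → q u w = q u' w') :
    ∃ Q : ℕ → α, ∀ u w, q u w = Q (G.dist u w) := by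
  refine ⟨fun h => if H : ∃ p : V × V, G.dist p.1 p.2 = h then q H.choose.1 H.choose.2
    else default, fun u w => ?_⟩
  have H : ∃ p : V × V, G.dist p.1 p.2 = G.dist u w := ⟨(u, w), rfl⟩
  simp only [dif_pos H]
  exact hq _ _ _ _ H.choose_spec.symm

theorem Connected.exists_adj_dist_eq (hG : G.Connected) {u w : V} {j : ℕ}
    (h : G.dist u w = j + 1) : ∃ v, G.Adj w v ∧ G.dist u v = j := by
  obtain ⟨p, hp⟩ := hG.exists_walk_length_eq_dist w u
  cases p with
  | nil => simp at h
  | @cons _ v _ hv p =>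
    refine ⟨v, hv, ?_⟩
    rw [Walk.length_cons, dist_comm, h] at hp
    have h1 := dist_le p
    have h2 := hG.dist_triangle (u := u) (v := v) (w := w)
    rw [dist_eq_one_iff_adj.2 hv.symm, h] at h2
    rw [dist_comm] at h1
    omega

variable [Fintype V]

/-- The number of neighbours of `v` at distance `j` from `u`. -/
noncomputable def nbrCount (G : SimpleGraph V) (u v : V) (j : ℕ) : ℕ :=
  #{w | G.Adj v w ∧ G.dist u w = j}

theorem IsDistanceRegular.nbrCount_eq (hG : G.IsDistanceRegular) {u v u' v' : V}
    (h : G.dist u v = G.dist u' v') (j : ℕ) : G.nbrCount u v j = G.nbrCount u' v' j := by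
  have := hG.2 u v u' v' h j
  rwa [Set.ncard_eq_toFinset_card', Set.ncard_eq_toFinset_card', Set.toFinset_ofPred,
    Set.toFinset_ofPred] at this

/-- The intersection numbers of a distance-regular graph are well-defined. -/
theorem IsDistanceRegular.card_dist_eq (hG : G.IsDistanceRegular) (j : ℕ) :
    ∀ u w u' w' : V, G.dist u w = G.dist u' w' → ∀ i,
      #{v | G.dist u v = i ∧ G.dist w v = j} = #{v | G.dist u' v = i ∧ G.dist w' v = j} := by
  obtain ⟨Q, hQ⟩ := G.exists_dist_factor (fun u v => G.nbrCount u v)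
    (fun u v u' v' h => funext fun j => hG.nbrCount_eq h j)
  induction j using Nat.strong_induction_on with
  | _ j ih =>
  cases j with
  | zero =>
    have key : ∀ u w : V, ∀ i, #{v | G.dist u v = i ∧ G.dist w v = 0} =
        if G.dist u w = i then 1 else 0 := by
      intro u w i
      simp only [hG.1.dist_eq_zero_iff]
      split_ifs with h
      · rw [Finset.card_eq_one]
        refine ⟨w, ?_⟩
        ext v
        simp only [Finset.mem_filter, Finset.mem_univ, true_and, Finset.mem_singleton]
        exact ⟨fun h => h.2.symm, fun e => ⟨e ▸ h, e.symm⟩⟩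
      · rw [Finset.card_eq_zero, Finset.filter_eq_empty_iff]
        rintro v _ ⟨h1, rfl⟩
        exact h h1
    intro u w u' w' h i
    rw [key, key, h]
  | succ j =>
    intro u w u' w' h i
    obtain ⟨F, hF⟩ := G.exists_dist_factor (fun u w => #{v | G.dist u v = i ∧ G.dist w v = j})
      (fun u w u' w' h => ih j (Nat.lt_succ_self j) u w u' w' h i)
    set K := Finset.univ.image fun p : V × V => G.dist p.1 p.2 with hK
    have hmem : ∀ x y, G.dist x y ∈ K := fun x y =>
      Finset.mem_image.2 ⟨(x, y), Finset.mem_univ _, rfl⟩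
    -- double counting of the pairs `(x, v)` with `x` adjacent to `w` and at distance `j` from `v`
    have hdouble : ∀ u w : V, ∑ x with G.Adj w x, #{v | G.dist u v = i ∧ G.dist x v = j} =
        ∑ v with G.dist u v = i, G.nbrCount v w j := by
      intro u w
      have := Finset.sum_card_bipartiteAbove_eq_sum_card_bipartiteBelow
        (s := ({x | G.Adj w x} : Finset V)) (t := ({v | G.dist u v = i} : Finset V))
        (fun x v => G.dist x v = j)
      simp only [Finset.bipartiteAbove, Finset.bipartiteBelow, Finset.filter_filter] at this
      rw [this]
      refine Finset.sum_congr rfl fun v _ => ?_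
      simp only [nbrCount, dist_comm]
    have hleft : ∀ u w : V, ∑ x with G.Adj w x, #{v | G.dist u v = i ∧ G.dist x v = j} =
        ∑ h ∈ K, G.nbrCount u w h * F h := by
      intro u w
      rw [← Finset.sum_fiberwise_of_maps_to (t := K) (g := fun x => G.dist u x)
        (fun x _ => hmem u x)]
      refine Finset.sum_congr rfl fun h _ => ?_
      rw [Finset.filter_filter, nbrCount, ← smul_eq_mul, ← Finset.sum_const]
      refine Finset.sum_congr rfl fun x hx => ?_
      simp only [Finset.mem_filter, Finset.mem_univ, true_and] at hx
      rw [hF, hx.2]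
    have hright : ∀ u w : V, ∑ v with G.dist u v = i, G.nbrCount v w j =
        ∑ h ∈ Finset.range (j + 2), #{v | G.dist u v = i ∧ G.dist w v = h} * Q h j := by
      intro u w
      have h1 : ∀ v, G.nbrCount v w j ≠ 0 → G.dist w v ∈ Finset.range (j + 2) := by
        intro v hv
        obtain ⟨x, hx⟩ := Finset.card_pos.1 (Nat.pos_of_ne_zero hv)
        simp only [Finset.mem_filter, Finset.mem_univ, true_and] at hx
        have h2 := hG.1.dist_triangle (u := w) (v := x) (w := v)
        rw [dist_eq_one_iff_adj.2 hx.1, dist_comm (u := x), hx.2] at h2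
        rw [Finset.mem_range]
        omega
      rw [← Finset.sum_filter_of_ne (p := fun v => G.dist w v ∈ Finset.range (j + 2))
        (fun v _ hv => h1 v hv),
        ← Finset.sum_fiberwise_of_maps_to (t := Finset.range (j + 2))
          (g := fun v => G.dist w v) (fun v hv => (Finset.mem_filter.1 hv).2)]
      refine Finset.sum_congr rfl fun h hh => ?_
      rw [← smul_eq_mul, ← Finset.sum_const, Finset.filter_filter, Finset.filter_filter]
      refine Finset.sum_congr ?_ fun v hv => ?_
      · ext v
        simp only [Finset.mem_filter, Finset.mem_univ, true_and]
        constructor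
        · rintro ⟨h2, _, h4⟩
          exact ⟨h2, h4⟩
        · rintro ⟨h2, h4⟩
          exact ⟨h2, h4 ▸ hh, h4⟩
      · simp only [Finset.mem_filter, Finset.mem_univ, true_and] at hv
        rw [hQ, dist_comm, hv.2]
    have hsum : ∑ h ∈ Finset.range (j + 2), #{v | G.dist u v = i ∧ G.dist w v = h} * Q h j =
        ∑ h ∈ Finset.range (j + 2), #{v | G.dist u' v = i ∧ G.dist w' v = h} * Q h j := by
      rw [← hright, ← hright, ← hdouble, ← hdouble, hleft, hleft]
      exact Finset.sum_congr rfl fun x _ => by rw [hG.nbrCount_eq h]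
    have hlow : ∑ h ∈ Finset.range (j + 1), #{v | G.dist u v = i ∧ G.dist w v = h} * Q h j =
        ∑ h ∈ Finset.range (j + 1), #{v | G.dist u' v = i ∧ G.dist w' v = h} * Q h j :=
      Finset.sum_congr rfl fun x hx => by rw [ih x (Finset.mem_range.1 hx) u w u' w' h i]
    rw [Finset.sum_range_succ _ (j + 1), Finset.sum_range_succ _ (j + 1), hlow] at hsum
    have hmul := Nat.add_left_cancel hsum
    -- Induction on `j` has isolated the top term of the recurrence. Its coefficient `Q (j + 1) j`
    -- is positive if distance `j + 1` occurs; otherwise both sets are empty.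
    by_cases hex : ∃ x y, G.dist x y = j + 1
    · obtain ⟨x, y, hxy⟩ := hex
      obtain ⟨v, hv⟩ := hG.1.exists_adj_dist_eq hxy
      have hpos : 0 < Q (j + 1) j := by
        rw [← hxy, ← hQ]
        exact Finset.card_pos.2 ⟨v, by simpa using hv⟩
      exact Nat.eq_of_mul_eq_mul_right hpos hmul
    · push Not at hex
      simp [hex]

theorem IsDistanceRegular.isSymmScheme (hG : G.IsDistanceRegular) : IsSymmScheme G.dist where
  symm _ _ := dist_comm
  eq_zero_iff _ _ := hG.1.dist_eq_zero_iff
  card_eq u w u' w' h i j := hG.card_dist_eq j u w u' w' h i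

end SimpleGraph

end DistanceRegular

/-! ### Greedy choice of a resolving set -/

section Greedy

open scoped Classical

/-- Greedy covering: if each `p ∈ P` is related to at least a proportion `x` of the points, then
some `k` points leave at most `#P * (1 - x) ^ k` members of `P` unrelated to all of them. -/
theorem exists_finset_card_unrelated_le {α Z : Type*} [Fintype Z] [Nonempty Z] (P : Finset α)
    (r : α → Z → Prop) {x : ℝ} (hx : x ≤ 1)
    (hr : ∀ p ∈ P, x * Fintype.card Z ≤ #{z | r p z}) (k : ℕ) :
    ∃ R : Finset Z, #R ≤ k ∧ (#{p ∈ P | ∀ z ∈ R, ¬ r p z} : ℝ) ≤ #P * (1 - x) ^ k := by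
  induction k with
  | zero => exact ⟨∅, by simp, by simp⟩
  | succ k ih =>
    obtain ⟨R, hR, hcard⟩ := ih
    set U := {p ∈ P | ∀ z ∈ R, ¬ r p z} with hU
    have hdouble : ∑ p ∈ U, #{z | r p z} = ∑ z : Z, #{p ∈ U | r p z} :=
      Finset.sum_card_bipartiteAbove_eq_sum_card_bipartiteBelow r
    have hsum : ∑ _z : Z, x * #U ≤ ∑ z : Z, (#{p ∈ U | r p z} : ℝ) := by
      rw [← Nat.cast_sum, ← hdouble, Nat.cast_sum, Finset.sum_const, nsmul_eq_mul,
        Finset.card_univ]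
      calc (Fintype.card Z : ℝ) * (x * #U) = ∑ _p ∈ U, x * Fintype.card Z := by
            rw [Finset.sum_const, nsmul_eq_mul]; ring
        _ ≤ _ := Finset.sum_le_sum fun p hp => hr p (Finset.mem_filter.1 hp).1
    obtain ⟨z, -, hz⟩ := Finset.exists_le_of_sum_le Finset.univ_nonempty hsum
    refine ⟨insert z R, (Finset.card_insert_le _ _).trans (Nat.succ_le_succ hR), ?_⟩
    have h1 : {p ∈ P | ∀ y ∈ insert z R, ¬ r p y} = {p ∈ U | ¬ r p z} := by
      ext p
      simp only [hU, Finset.mem_filter, Finset.forall_mem_insert]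
      tauto
    have h2 := Finset.card_filter_add_card_filter_not (s := U) (fun p => r p z)
    have h3 : (#{p ∈ U | r p z} : ℝ) + #{p ∈ U | ¬ r p z} = #U := by exact_mod_cast h2
    rw [h1, pow_succ]
    calc (#{p ∈ U | ¬ r p z} : ℝ) ≤ #U * (1 - x) := by linarith
      _ ≤ #P * (1 - x) ^ k * (1 - x) := mul_le_mul_of_nonneg_right hcard (by linarith)
      _ = _ := by ring

theorem one_sub_le_exp_neg_add_sq {x : ℝ} (h0 : 0 ≤ x) (h1 : x < 1) :
    1 - x ≤ Real.exp (-(x + x ^ 2 / 2)) := by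
  have h := Real.hasSum_pow_div_log_of_abs_lt_one (x := x) (by rwa [abs_of_nonneg h0])
  have h2 := sum_le_hasSum (Finset.range 2) (fun i _ => by positivity) h
  norm_num [Finset.sum_range_succ] at h2
  rw [← Real.log_le_iff_le_exp (by linarith)]
  linarith

/-- Only `k + 1`, not `k`, is known to reach `2 log N / x`. The quadratic term of the exponential
bound pays for the missing step once `log N ≥ 1 + x / 2`, which `x ≤ 1 / 2` and `log N ≥ 5 / 4`
ensure. -/
theorem mul_one_sub_pow_lt_one {N k : ℕ} {x : ℝ} (hN : 4 ≤ N) (h0 : 0 < x) (h1 : x ≤ 1 / 2)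
    (hk : 2 * Real.log N / x ≤ k + 1) : (N : ℝ) * (N - 1) * (1 - x) ^ k < 1 := by
  have hN' : (4 : ℝ) ≤ N := by exact_mod_cast hN
  have hlog : 5 / 4 ≤ Real.log N := by
    have h2 : Real.log 4 ≤ Real.log N := Real.log_le_log (by norm_num) hN'
    have h3 : Real.log 4 = 2 * Real.log 2 := by
      rw [show (4 : ℝ) = 2 ^ 2 by norm_num, Real.log_pow]; norm_num
    have := Real.log_two_gt_d9
    linarith
  have hexp : (1 - x) ^ k ≤ Real.exp (-(2 * Real.log N)) := by
    refine (pow_le_pow_left₀ (by linarith)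
      (one_sub_le_exp_neg_add_sq h0.le (by linarith)) k).trans ?_
    rw [← Real.exp_nat_mul, Real.exp_le_exp]
    rw [div_le_iff₀ h0] at hk
    have h4 : 0 ≤ (1 + x / 2) * (((k : ℝ) + 1) * x - 2 * Real.log N) :=
      mul_nonneg (by linarith) (by linarith)
    have h5 : 0 ≤ x * (Real.log N - 5 / 4) := mul_nonneg h0.le (by linarith)
    nlinarith [mul_nonneg h0.le (by linarith : (0 : ℝ) ≤ 1 / 2 - x)]
  have hval : Real.exp (-(2 * Real.log N)) = ((N : ℝ) ^ 2)⁻¹ := by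
    rw [Real.exp_neg, show 2 * Real.log (N : ℝ) = Real.log N + Real.log N by ring, Real.exp_add,
      Real.exp_log (by linarith), sq]
  rw [hval] at hexp
  calc (N : ℝ) * (N - 1) * (1 - x) ^ k ≤ N * (N - 1) * ((N : ℝ) ^ 2)⁻¹ :=
        mul_le_mul_of_nonneg_left hexp (mul_nonneg (by linarith) (by linarith))
    _ < 1 := by
        rw [← div_eq_mul_inv, div_lt_one (by positivity)]
        nlinarith

namespace SimpleGraph

variable {V : Type*} {G : SimpleGraph V}

theorem metricDim_le_card {R : Finset V} (hR : G.IsResolvingSet R) : G.metricDim ≤ #R :=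
  Nat.sInf_le ⟨R, hR, rfl⟩

variable [Fintype V]

/-- In a graph whose vertices fall into two halves of size `N` according to the parity of their
distances, if each pair in the same half is resolved by at least a proportion `x` of the
vertices, then the metric dimension is less than `2 * log N / x`. -/
theorem metricDim_lt_of_resolvers
    (hpar : ∀ u v w, Even (G.dist u w) ↔ (Even (G.dist u v) ↔ Even (G.dist w v)))
    {N : ℕ} (hN : 4 ≤ N) (hhalf : ∀ u, #{w | Even (G.dist u w)} = N)
    (hcard : Fintype.card V = 2 * N) {x : ℝ} (h0 : 0 < x) (h1 : x ≤ 1 / 2)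
    (hres : ∀ u w, u ≠ w → Even (G.dist u w) →
      x * Fintype.card V ≤ #(resolvers G.dist u w)) :
    (G.metricDim : ℝ) < 2 * Real.log N / x := by
  have : Nonempty V := Fintype.card_pos_iff.1 (by omega)
  set B := 2 * Real.log N / x with hB
  have hBpos : 0 < B :=
    div_pos (mul_pos two_pos (Real.log_pos (by exact_mod_cast (by omega : 1 < N)))) h0
  obtain ⟨k, hk⟩ : ∃ k, ⌈B⌉₊ = k + 1 := Nat.exists_eq_succ_of_ne_zero (Nat.ceil_pos.2 hBpos).ne'
  have hkB : (k : ℝ) < B := Nat.lt_ceil.1 (by omega)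
  have hBk : B ≤ k + 1 := by
    have := Nat.le_ceil B
    rw [hk] at this
    exact_mod_cast this
  set P : Finset (V × V) := {p | p.1 ≠ p.2 ∧ Even (G.dist p.1 p.2)} with hP
  have hPcard : #P = 2 * N * (N - 1) := by
    have hfib : ∀ u ∈ Finset.univ, #{p ∈ P | p.1 = u} = N - 1 := by
      intro u _
      rw [← hhalf u, ← Finset.card_erase_of_mem (a := u) (by simp)]
      refine Finset.card_nbij' Prod.snd (fun w => (u, w)) ?_ ?_ ?_ ?_
      · rintro ⟨a, b⟩ h
        simp only [hP, Finset.coe_filter, Set.mem_ofPred_eq, Finset.mem_filter, Finset.mem_univ,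
          true_and] at h
        obtain ⟨⟨h2, h3⟩, rfl⟩ := h
        simp [h3, h2.symm]
      · intro w h
        simp only [Finset.coe_erase, Set.mem_sdiff, Finset.mem_coe, Finset.mem_filter,
          Finset.mem_univ, true_and, Set.mem_singleton_iff] at h
        simp [hP, h.1, Ne.symm h.2]
      · rintro ⟨a, b⟩ h
        simp only [Finset.coe_filter, Set.mem_ofPred_eq] at h
        simp [h.2]
      · intro w _
        rfl
    rw [Finset.card_eq_sum_card_fiberwise (f := Prod.fst) (t := Finset.univ)
      (fun _ _ => by simp), Finset.sum_congr rfl hfib]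
    simp [hcard]
  obtain ⟨R, hR, hU⟩ := exists_finset_card_unrelated_le P
    (fun p z => G.dist p.1 z ≠ G.dist p.2 z) (x := x) (by linarith)
    (fun p hp => by
      have hp' := (Finset.mem_filter.1 hp).2
      convert hres p.1 p.2 hp'.1 hp'.2
      ext z
      simp [mem_resolvers]) k
  simp only [ne_eq, not_not] at hU
  set U := {p ∈ P | ∀ z ∈ R, G.dist p.1 z = G.dist p.2 z} with hUdef
  -- Pairs are ordered and `U` is closed under swapping, so fewer than two elements means none.
  have hUlt : #U < 2 := by
    have h2 := mul_one_sub_pow_lt_one hN h0 h1 hBk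
    have h3 : (#P : ℝ) = 2 * N * (N - 1) := by
      rw [hPcard]; push_cast [Nat.cast_sub (by omega : 1 ≤ N)]; ring
    rw [h3] at hU
    have h4 : (#U : ℝ) < 2 := by linarith
    exact_mod_cast h4
  have hUempty : ∀ p, p ∉ U := by
    intro p hp
    have hp2 : p.swap ∈ U := by
      simp only [hUdef, hP, Finset.mem_filter, Finset.mem_univ, true_and, Prod.fst_swap,
        Prod.snd_swap] at hp ⊢
      exact ⟨⟨hp.1.1.symm, dist_comm (G := G) ▸ hp.1.2⟩, fun z hz => (hp.2 z hz).symm⟩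
    have hne : p ≠ p.swap := by
      intro e
      have h2 := (Finset.mem_filter.1 (Finset.mem_filter.1 hp).1).2.1
      exact h2 (congrArg Prod.fst e)
    have h3 : ({p, p.swap} : Finset (V × V)) ⊆ U := by
      intro q hq
      rcases Finset.mem_insert.1 hq with rfl | hq
      · exact hp
      · exact Finset.mem_singleton.1 hq ▸ hp2
    have h4 := Finset.card_le_card h3
    rw [Finset.card_pair hne] at h4
    omega
  -- One member of `R` is needed to resolve, by parity, the pairs from different halves.
  obtain ⟨z₀, hz₀⟩ : R.Nonempty := by
    rw [Finset.nonempty_iff_ne_empty]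
    rintro rfl
    have h2 : 0 < #P := by rw [hPcard]; exact Nat.mul_pos (by omega) (by omega)
    obtain ⟨p, hp⟩ := Finset.card_pos.1 h2
    exact hUempty p (Finset.mem_filter.2 ⟨hp, by simp⟩)
  have hresolving : G.IsResolvingSet R := by
    intro u w huw
    by_cases he : Even (G.dist u w)
    · by_contra! hno
      exact hUempty (u, w) (Finset.mem_filter.2
        ⟨Finset.mem_filter.2 ⟨Finset.mem_univ _, huw, he⟩, hno⟩)
    · refine ⟨z₀, hz₀, fun e => he ?_⟩
      rw [hpar u z₀ w, e]
  calc (G.metricDim : ℝ) ≤ #R := by exact_mod_cast metricDim_le_card hresolving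
    _ ≤ k := by exact_mod_cast hR
    _ < B := hkB

end SimpleGraph

end Greedy

/-! ### The halves of a bipartite distance-regular graph -/

section Halves

open scoped Classical

namespace SimpleGraph

variable {V : Type*} {G : SimpleGraph V}

theorem Connected.exists_dist_eq_of_le (hG : G.Connected) {u : V} {i : ℕ} :
    ∀ {w : V}, i ≤ G.dist u w → ∃ v, G.dist u v = i := by
  suffices H : ∀ m w, G.dist u w = i + m → ∃ v, G.dist u v = i by
    intro w h
    obtain ⟨m, hm⟩ := Nat.exists_eq_add_of_le h
    exact H m w hm
  intro m
  induction m with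
  | zero => exact fun w h => ⟨w, h⟩
  | succ m ih =>
    intro w h
    obtain ⟨v, -, hv⟩ := hG.exists_adj_dist_eq (j := i + m) (by rw [h, add_assoc])
    exact ih v hv

theorem IsBipartite.even_dist_iff (hbip : G.IsBipartite) (hG : G.Connected) (u v w : V) :
    Even (G.dist u w) ↔ (Even (G.dist u v) ↔ Even (G.dist w v)) := by
  let c : G.Coloring Bool := Colorable.toColoring hbip (by simp)
  have key : ∀ x y, Even (G.dist x y) ↔ (c x ↔ c y) := by
    intro x y
    obtain ⟨p, hp⟩ := hG.exists_walk_length_eq_dist x y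
    rw [← hp]
    exact c.even_length_iff_congr p
  rw [key, key, key]
  tauto

/-- Every second vertex of a geodesic of `G` gives a walk in the halved graph. -/
theorem exists_halvedGraph_walk (hG : G.Connected) (C : G.HalvedIndex) {x : V} (hx : x ∈ C.supp)
    (m : ℕ) : ∀ y, G.dist x y = 2 * m →
      ∃ hy : y ∈ C.supp, ∃ p : (G.halvedGraph C).Walk ⟨x, hx⟩ ⟨y, hy⟩, p.length = m := by
  induction m with
  | zero =>
    intro y h
    obtain rfl := hG.dist_eq_zero_iff.1 h
    exact ⟨hx, .nil, rfl⟩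
  | succ m ih =>
    intro y h
    obtain ⟨v, hv, hxv⟩ := hG.exists_adj_dist_eq (j := 2 * m + 1) (by rw [h]; ring)
    obtain ⟨z, hz, hxz⟩ := hG.exists_adj_dist_eq hxv
    obtain ⟨hzC, p, hp⟩ := ih z hxz
    have h1 : G.dist z y ≤ 2 := by
      have := hG.dist_triangle (u := z) (v := v) (w := y)
      rwa [dist_eq_one_iff_adj.2 hz.symm, dist_eq_one_iff_adj.2 hv.symm] at this
    have h2 := hG.dist_triangle (u := x) (v := z) (w := y)
    have h3 : G.dist z y = 2 := by omega
    have hadj : (G.distanceGraph 2).Adj z y := by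
      refine ⟨?_, h3⟩
      rintro rfl
      simp at h3
    have hyC : y ∈ C.supp := (C.mem_supp_congr_adj hadj).1 hzC
    have hadj' : (G.halvedGraph C).Adj ⟨z, hzC⟩ ⟨y, hyC⟩ := hadj
    exact ⟨hyC, p.concat hadj', by rw [Walk.length_concat, hp]⟩

theorem dist_le_two_mul_length (hG : G.Connected) {C : G.HalvedIndex} {x y : C.supp}
    (p : (G.halvedGraph C).Walk x y) : G.dist x.1 y.1 ≤ 2 * p.length := by
  induction p with
  | nil => simp
  | @cons x z y h p ih =>
    have h1 := hG.dist_triangle (u := x.1) (v := z.1) (w := y.1)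
    have h2 : G.dist x.1 z.1 = 2 := h.2
    rw [Walk.length_cons]
    omega

theorem mem_supp_iff_even_dist (hbip : G.IsBipartite) (hG : G.Connected) {C : G.HalvedIndex}
    {x : V} (hx : x ∈ C.supp) (y : V) : y ∈ C.supp ↔ Even (G.dist x y) := by
  constructor
  · intro hy
    have hreach : (G.distanceGraph 2).Reachable x y := by
      rw [ConnectedComponent.mem_supp_iff] at hx hy
      exact ConnectedComponent.exact (hx.trans hy.symm)
    obtain ⟨p⟩ := hreach
    clear hx hy
    induction p with
    | nil => simp
    | @cons x z y h p ih =>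
      rw [hbip.even_dist_iff hG x z y, h.2, dist_comm]
      simpa using ih
  · intro he
    obtain ⟨m, hm⟩ := he
    exact (exists_halvedGraph_walk hG C hx m y (by omega)).1

theorem halvedGraph_connected (hbip : G.IsBipartite) (hG : G.Connected) (C : G.HalvedIndex) :
    (G.halvedGraph C).Connected := by
  obtain ⟨x, hx⟩ := C.nonempty_supp
  have : Nonempty C.supp := ⟨⟨x, hx⟩⟩
  refine Connected.mk fun x y => ?_
  obtain ⟨m, hm⟩ := (mem_supp_iff_even_dist hbip hG x.2 y.1).1 y.2
  obtain ⟨_, p, _⟩ := exists_halvedGraph_walk hG C x.2 m y.1 (by omega)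
  exact ⟨p⟩

theorem dist_eq_two_mul_halvedGraph_dist (hbip : G.IsBipartite) (hG : G.Connected)
    {C : G.HalvedIndex} (x y : C.supp) : G.dist x.1 y.1 = 2 * (G.halvedGraph C).dist x y := by
  obtain ⟨m, hm⟩ := (mem_supp_iff_even_dist hbip hG x.2 y.1).1 y.2
  obtain ⟨_, p, hp⟩ := exists_halvedGraph_walk hG C x.2 m y.1 (by omega)
  obtain ⟨q, hq⟩ := (halvedGraph_connected hbip hG C).exists_walk_length_eq_dist x y
  have h1 : (G.halvedGraph C).dist x y ≤ p.length := dist_le p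
  have h2 := dist_le_two_mul_length hG q
  omega

variable [Fintype V]

theorem card_supp_filter (C : G.HalvedIndex) [Fintype C.supp] (p : V → Prop)
    [DecidablePred fun x : C.supp => p x.1] [DecidablePred fun v => v ∈ C.supp ∧ p v] :
    #{x : C.supp | p x.1} = #{v | v ∈ C.supp ∧ p v} := by
  rw [← Finset.card_map (Function.Embedding.subtype _)]
  congr 1
  ext v
  simp only [Finset.mem_map, Finset.mem_filter, Finset.mem_univ, true_and,
    Function.Embedding.coe_subtype, Subtype.exists, exists_and_right, exists_eq_right]
  exact ⟨fun ⟨h, h'⟩ => ⟨h, h'⟩, fun ⟨h, h'⟩ => ⟨h, h'⟩⟩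

/-- Even intersection numbers are those of `G`, since the vertices they count stay in the half; odd
distances do not occur there. -/
theorem IsDistanceRegular.isSymmScheme_half (hG : G.IsDistanceRegular) (hbip : G.IsBipartite)
    (C : G.HalvedIndex) : IsSymmScheme fun x y : C.supp => G.dist x.1 y.1 where
  symm _ _ := dist_comm
  eq_zero_iff _ _ := hG.1.dist_eq_zero_iff.trans Subtype.ext_iff.symm
  card_eq u w u' w' h i j := by
    have key : ∀ u w : C.supp, #{v : C.supp | G.dist u.1 v.1 = i ∧ G.dist w.1 v.1 = j} =
        if Even i then #{v | G.dist u.1 v = i ∧ G.dist w.1 v = j} else 0 := by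
      intro u w
      rw [card_supp_filter C fun v => G.dist u.1 v = i ∧ G.dist w.1 v = j]
      split_ifs with hi
      · congr 1
        ext v
        simp only [Finset.mem_filter, Finset.mem_univ, true_and, and_iff_right_iff_imp]
        rintro ⟨rfl, -⟩
        exact (mem_supp_iff_even_dist hbip hG.1 u.2 v).2 hi
      · rw [Finset.card_eq_zero, Finset.filter_eq_empty_iff]
        rintro v - ⟨h1, rfl, -⟩
        exact hi ((mem_supp_iff_even_dist hbip hG.1 u.2 v).1 h1)
    rw [key, key, hG.isSymmScheme.card_eq u.1 w.1 u'.1 w'.1 h i j]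

theorem colorGraph_half_connected (hbip : G.IsBipartite) (hG : G.Connected) {C : G.HalvedIndex}
    (hC : (G.halvedGraph C).IsPrimitive) {u w : C.supp} (huw : u ≠ w) :
    (colorGraph (fun x y : C.supp => G.dist x.1 y.1) (fun _ _ => dist_comm)
      (G.dist u.1 w.1)).Connected := by
  have hconn := halvedGraph_connected hbip hG C
  have : Nonempty C.supp := ⟨u⟩
  have h1 := hC ((G.halvedGraph C).dist u w) (hconn.pos_dist_of_ne huw)
    (dist_le_diam (connected_iff_ediam_ne_top.1 hconn))
  convert h1 using 1
  ext x y
  simp only [colorGraph, distanceGraph, dist_eq_two_mul_halvedGraph_dist hbip hG]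
  exact and_congr_right fun _ => by omega

theorem IsDistanceRegular.exists_dist_eq (hG : G.IsDistanceRegular) (u : V) {i : ℕ}
    (hi : i ≤ G.diam) : ∃ v, G.dist u v = i := by
  have := hG.1.nonempty
  obtain ⟨x, y, hxy⟩ := G.exists_dist_eq_diam
  obtain ⟨v, hv⟩ := hG.1.exists_dist_eq_of_le (hi.trans hxy.ge)
  have h1 : 0 < #{v | G.dist x v = i} := Finset.card_pos.2 ⟨v, by simpa using hv⟩
  rw [hG.isSymmScheme.card_color_eq x u] at h1
  obtain ⟨z, hz⟩ := Finset.card_pos.1 h1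
  exact ⟨z, by simpa using hz⟩

theorem IsDistanceRegular.card_even_dist_eq (hG : G.IsDistanceRegular) (u u' : V) :
    #{w | Even (G.dist u w)} = #{w | Even (G.dist u' w)} := by
  have key : ∀ u : V, #{w | Even (G.dist u w)} =
      ∑ i ∈ Finset.univ.image fun p : V × V => G.dist p.1 p.2,
        if Even i then #{w | G.dist u w = i} else 0 := by
    intro u
    rw [Finset.card_eq_sum_card_fiberwise (f := fun w => G.dist u w)
      (t := Finset.univ.image fun p : V × V => G.dist p.1 p.2)]
    · refine Finset.sum_congr rfl fun i _ => ?_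
      rw [Finset.filter_filter]
      split_ifs with hi
      · congr 1
        ext w
        simp only [Finset.mem_filter, Finset.mem_univ, true_and, and_iff_right_iff_imp]
        rintro rfl
        exact hi
      · rw [Finset.card_eq_zero, Finset.filter_eq_empty_iff]
        rintro w - ⟨h1, rfl⟩
        exact hi h1
    · intro w _
      exact Finset.mem_coe.2 (Finset.mem_image.2 ⟨(u, w), Finset.mem_univ _, rfl⟩)
  rw [key, key]
  exact Finset.sum_congr rfl fun i _ => by rw [hG.isSymmScheme.card_color_eq u u']

theorem IsDistanceRegular.card_eq_two_mul (hG : G.IsDistanceRegular) (hbip : G.IsBipartite)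
    (hd : 1 ≤ G.diam) (u : V) : Fintype.card V = 2 * #{w | Even (G.dist u w)} := by
  obtain ⟨y, hy⟩ := hG.exists_dist_eq u hd
  have h1 := Finset.card_filter_add_card_filter_not (s := (Finset.univ : Finset V))
    (fun w => Even (G.dist u w))
  have h2 : #{w | ¬ Even (G.dist u w)} = #{w | Even (G.dist y w)} := by
    congr 1
    ext w
    simp only [Finset.mem_filter, Finset.mem_univ, true_and]
    rw [hbip.even_dist_iff hG.1 u y w, hy, dist_comm (u := w)]
    simp
  rw [h2, hG.card_even_dist_eq y u, Finset.card_univ] at h1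
  omega

theorem card_sphere_le_maxSphereCard (hG : G.Connected) (v : V) (i : ℕ) :
    #{w | G.dist v w = i} ≤ G.maxSphereCard := by
  by_cases hi : i ≤ G.diam
  · have h1 : #{w | G.dist v w = i} = {w : V | G.dist v w = i}.ncard := by
      rw [Set.ncard_eq_toFinset_card', Set.toFinset_ofPred]
    rw [h1, maxSphereCard]
    refine le_trans ?_ (Finset.le_sup (Finset.mem_univ v))
    exact Finset.le_sup (f := fun i : ℕ => {w : V | G.dist v w = i}.ncard)
      (Finset.mem_range.2 (Nat.lt_succ_of_le hi))
  · have : Nonempty V := ⟨v⟩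
    rw [Finset.card_eq_zero.2]
    · exact Nat.zero_le _
    · rw [Finset.filter_eq_empty_iff]
      rintro w - rfl
      exact hi (dist_le_diam (connected_iff_ediam_ne_top.1 hG))

/-- A sphere lies in one half, and that half also contains a vertex at another distance of the same
parity; distances up to `3` suffice to find one. -/
theorem IsDistanceRegular.maxSphereCard_lt (hG : G.IsDistanceRegular) (hbip : G.IsBipartite)
    (hd : 3 ≤ G.diam) (u : V) : G.maxSphereCard < #{w | Even (G.dist u w)} := by
  have hpos : 0 < #{w | Even (G.dist u w)} := Finset.card_pos.2 ⟨u, by simp⟩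
  rw [maxSphereCard, Finset.sup_lt_iff (by simpa using hpos)]
  intro v _
  rw [Finset.sup_lt_iff (by simpa using hpos)]
  intro i _
  rw [Set.ncard_eq_toFinset_card', Set.toFinset_ofPred]
  have h1 := hG.card_eq_two_mul hbip (by omega) v
  have h2 := Finset.card_filter_add_card_filter_not (s := (Finset.univ : Finset V))
    (fun w => Even (G.dist v w))
  rw [Finset.card_univ] at h2
  rw [hG.card_even_dist_eq u v]
  obtain ⟨j, hj, hji, hpar⟩ : ∃ j, j ≤ 3 ∧ j ≠ i ∧ (Even j ↔ Even i) := by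
    by_cases he : Even i
    · by_cases h0 : i = 0
      · exact ⟨2, by omega, by omega, by simp [h0]⟩
      · exact ⟨0, by omega, by omega, by simp [he]⟩
    · by_cases h0 : i = 1
      · exact ⟨3, by omega, by omega, by subst h0; decide⟩
      · exact ⟨1, by omega, by omega, by simp [he]⟩
  obtain ⟨z, hz⟩ := hG.exists_dist_eq v (hj.trans hd)
  have hlt : #{w | G.dist v w = i} < #{w | Even (G.dist v w) ↔ Even i} := by
    refine Finset.card_lt_card (Finset.ssubset_iff_of_subset ?_ |>.2 ⟨z, ?_, ?_⟩)
    · intro w hw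
      simp only [Finset.mem_filter, Finset.mem_univ, true_and] at hw ⊢
      rw [hw]
    · simpa [hz] using hpar
    · simpa [hz] using hji
  refine hlt.trans_eq ?_
  by_cases he : Even i
  · simp only [he, iff_true]
  · simp only [he, iff_false]
    omega

/-- The four vertices are `u`, one at distance `4`, and two at distance `2`. The last two exist
because `z`, midway between `u` and `y`, has both of these at distance `2`. -/
theorem IsDistanceRegular.four_le_card_half (hG : G.IsDistanceRegular) (hd : 4 ≤ G.diam)
    (u : V) : 4 ≤ #{w | Even (G.dist u w)} := by
  obtain ⟨y, hy⟩ := hG.exists_dist_eq u hd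
  obtain ⟨x, hx, hux⟩ := hG.1.exists_adj_dist_eq hy
  obtain ⟨z, hz, huz⟩ := hG.1.exists_adj_dist_eq hux
  have hzy : G.dist z y = 2 := by
    have h1 := hG.1.dist_triangle (u := u) (v := z) (w := y)
    have h2 := hG.1.dist_triangle (u := z) (v := x) (w := y)
    rw [dist_eq_one_iff_adj.2 hz.symm, dist_eq_one_iff_adj.2 hx.symm] at h2
    omega
  have hk : 2 ≤ #{w | G.dist z w = 2} := by
    have hsub : ({u, y} : Finset V) ⊆ ({w | G.dist z w = 2} : Finset V) := by
      intro w hw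
      simp only [Finset.mem_insert, Finset.mem_singleton] at hw
      rcases hw with rfl | rfl
      · simp [dist_comm (u := z), huz]
      · simp [hzy]
    have hne : u ≠ y := by
      rintro rfl
      simp at hy
    have := Finset.card_le_card hsub
    rwa [Finset.card_pair hne] at this
  rw [hG.isSymmScheme.card_color_eq z u] at hk
  have hsub : insert u (insert y ({w | G.dist u w = 2} : Finset V)) ⊆
      ({w | Even (G.dist u w)} : Finset V) := by
    intro w hw
    simp only [Finset.mem_insert, Finset.mem_filter, Finset.mem_univ, true_and] at hw ⊢
    rcases hw with rfl | rfl | hw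
    · simp
    · rw [hy]; decide
    · rw [hw]; decide
  have hcard := Finset.card_le_card hsub
  rw [Finset.card_insert_of_notMem, Finset.card_insert_of_notMem] at hcard
  · omega
  · simp [hy]
  · simp only [Finset.mem_insert, Finset.mem_filter, Finset.mem_univ, true_and, dist_self, not_or]
    refine ⟨?_, by omega⟩
    rintro rfl
    simp at hy

/-! ### Lower bounds for the resolvers of a pair in one half -/

section Primitive

variable (hbip : G.IsBipartite) (hG : G.IsDistanceRegular) (hd : 4 ≤ G.diam)
  (hprim : ∀ C : G.HalvedIndex, (G.halvedGraph C).IsPrimitive)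

include hbip hG hd hprim

/-- Resolvers inside the half already suffice. Distances `2` and `4` supply the two nontrivial
colours. -/
theorem card_half_le_card_resolvers_sq {u w : V} (huw : u ≠ w) (he : Even (G.dist u w)) :
    #{v | Even (G.dist u v)} ≤ #(resolvers G.dist u w) ^ 2 := by
  set C : G.HalvedIndex := (G.distanceGraph 2).connectedComponentMk u with hC
  have hu : u ∈ C.supp := ConnectedComponent.connectedComponentMk_mem
  have hmem := mem_supp_iff_even_dist hbip hG.1 hu
  have hcardC : Fintype.card C.supp = #{v | Even (G.dist u v)} := by
    simp [hmem]
  have hsch := hG.isSymmScheme_half hbip C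
  obtain ⟨x, hx⟩ := hG.exists_dist_eq u (i := 2) (by omega)
  obtain ⟨y, hy⟩ := hG.exists_dist_eq u hd
  have hxC : x ∈ C.supp := (hmem x).2 (by rw [hx]; decide)
  have hyC : y ∈ C.supp := (hmem y).2 (by rw [hy]; decide)
  have hrank : ∃ a b : C.supp, a ≠ b ∧ G.dist a.1 b.1 ≠ G.dist u w := by
    by_cases h2 : G.dist u w = 2
    · refine ⟨⟨u, hu⟩, ⟨y, hyC⟩, fun e => ?_, by simp only; omega⟩
      obtain rfl : u = y := congrArg Subtype.val e
      simp at hy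
    · refine ⟨⟨u, hu⟩, ⟨x, hxC⟩, fun e => ?_, by simp only; omega⟩
      obtain rfl : u = x := congrArg Subtype.val e
      simp at hx
  have hmain := hsch.card_le_card_resolvers_sq
    (fun a b hab => colorGraph_half_connected hbip hG.1 (hprim C) hab)
    (u₀ := ⟨u, hu⟩) (w₀ := ⟨w, (hmem w).2 he⟩)
    (fun e => huw (congrArg Subtype.val e)) hrank
  rw [hcardC] at hmain
  refine hmain.trans (Nat.pow_le_pow_left ?_ 2)
  rw [resolvers, card_supp_filter C fun v => G.dist u v ≠ G.dist w v]
  refine Finset.card_le_card fun v hv => ?_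
  exact mem_resolvers.2 (Finset.mem_filter.1 hv).2.2

theorem card_half_sub_le_diam_mul {u w : V} (huw : u ≠ w) (he : Even (G.dist u w)) :
    4 * (#{v | Even (G.dist u v)} - G.maxSphereCard) ≤
      G.diam * #(resolvers G.dist u w) := by
  set C : G.HalvedIndex := (G.distanceGraph 2).connectedComponentMk u with hC
  have hu : u ∈ C.supp := ConnectedComponent.connectedComponentMk_mem
  have hmem := mem_supp_iff_even_dist hbip hG.1 hu
  have hcardC : Fintype.card C.supp = #{v | Even (G.dist u v)} := by
    simp [hmem]
  have : Nonempty V := ⟨u⟩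
  have hsch := hG.isSymmScheme_half hbip C
  have hwC := (hmem w).2 he
  -- Points range over the half but resolvers over all of `V`, which gains a factor `2`. The colours
  -- are the even distances `2, 4, …, 2⌊d/2⌋`.
  have hmain := hsch.card_mul_le_card_resolvers (fun (x : C.supp) (v : V) => G.dist x.1 v)
    (fun a b a' b' h => hG.isSymmScheme.card_resolvers_eq h)
    (M := G.maxSphereCard) (fun z i => by
      rw [card_supp_filter C fun v => G.dist v z = i]
      refine (Finset.card_le_card fun v hv => ?_).trans
        (card_sphere_le_maxSphereCard hG.1 z i)
      simp only [Finset.mem_filter, Finset.mem_univ, true_and] at hv ⊢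
      rw [dist_comm, hv.2])
    (S := (Finset.Icc 1 (G.diam / 2)).image (2 * ·)) (fun a b hab => by
      obtain ⟨m, hm⟩ := (mem_supp_iff_even_dist hbip hG.1 a.2 b.1).1 b.2
      have h1 : G.dist a.1 b.1 ≤ G.diam := dist_le_diam (connected_iff_ediam_ne_top.1 hG.1)
      have h2 := hG.1.pos_dist_of_ne fun e => hab (Subtype.ext e)
      exact Finset.mem_image.2 ⟨m, Finset.mem_Icc.2 ⟨by omega, by omega⟩, by omega⟩)
    (u₀ := ⟨u, hu⟩) (w₀ := ⟨w, hwC⟩)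
    (colorGraph_half_connected hbip hG.1 (hprim C) fun e => huw (congrArg Subtype.val e))
  have hS : #((Finset.Icc 1 (G.diam / 2)).image (2 * ·)) ≤ G.diam / 2 :=
    Finset.card_image_le.trans (by simp)
  change _ ≤ _ * (_ * #(resolvers G.dist u w)) at hmain
  rw [hcardC, hG.card_eq_two_mul hbip (by omega) u] at hmain
  have hpos : 0 < #{v | Even (G.dist u v)} := Finset.card_pos.2 ⟨u, by simp⟩
  have h1 : 2 * (#{v | Even (G.dist u v)} - G.maxSphereCard) ≤
      G.diam / 2 * #(resolvers G.dist u w) := by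
    refine le_of_mul_le_mul_left ?_ hpos
    calc _ = 2 * #{v | Even (G.dist u v)} * (#{v | Even (G.dist u v)} - G.maxSphereCard) := by
          ring
      _ ≤ _ := hmain.trans (Nat.mul_le_mul_left _ (Nat.mul_le_mul_right _ hS))
  calc 4 * (#{v | Even (G.dist u v)} - G.maxSphereCard)
      = 2 * (2 * (#{v | Even (G.dist u v)} - G.maxSphereCard)) := by ring
    _ ≤ 2 * (G.diam / 2 * #(resolvers G.dist u w)) := Nat.mul_le_mul_left 2 h1
    _ = 2 * (G.diam / 2) * #(resolvers G.dist u w) := by ring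
    _ ≤ _ := Nat.mul_le_mul_right _ (Nat.mul_div_le _ _)

end Primitive

end SimpleGraph

end Halves

/-! ### The two bounds on the metric dimension -/

theorem mainTheorem10 {V : Type*} [Fintype V] (G : SimpleGraph V)
    (hbip : G.IsBipartite) (hdr : G.IsDistanceRegular) (hdiam : 4 ≤ G.diam)
    (hprim : ∀ C : G.HalvedIndex, (G.halvedGraph C).IsPrimitive ∧ 2 ≤ (G.halvedGraph C).diam) :
    (G.metricDim : ℝ) <
        2 * Real.sqrt (2 * (Fintype.card V : ℝ)) * Real.log ((Fintype.card V : ℝ) / 2) ∧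
      (G.metricDim : ℝ) <
        (G.diam : ℝ) *
            ((Fintype.card V : ℝ) / ((Fintype.card V : ℝ) - 2 * (G.maxSphereCard : ℝ))) *
          Real.log ((Fintype.card V : ℝ) / 2) := by
  classical
  obtain ⟨u₀⟩ := hdr.1.nonempty
  obtain ⟨N, hN⟩ : ∃ N, N = #{w | Even (G.dist u₀ w)} := ⟨_, rfl⟩
  have hhalf : ∀ u, #{w | Even (G.dist u w)} = N := fun u => by
    rw [hN]
    convert hdr.card_even_dist_eq u u₀
  have hN4 : 4 ≤ N := by
    rw [hN]
    convert hdr.four_le_card_half hdiam u₀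
  have hcard : Fintype.card V = 2 * N := by
    rw [hN]
    convert hdr.card_eq_two_mul hbip (by omega) u₀
  have hM : G.maxSphereCard < N := by
    rw [hN]
    convert hdr.maxSphereCard_lt hbip (by omega) u₀
  have hcardR : (Fintype.card V : ℝ) = 2 * N := by exact_mod_cast hcard
  have hNR : (4 : ℝ) ≤ N := by exact_mod_cast hN4
  have hMR : (G.maxSphereCard : ℝ) < N := by exact_mod_cast hM
  have hdR : (4 : ℝ) ≤ G.diam := by exact_mod_cast hdiam
  have hhalfdiv : (2 * N : ℝ) / 2 = N := by ring
  have hmetric : ∀ x : ℝ, 0 < x → x ≤ 1 / 2 →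
      (∀ u w, u ≠ w → Even (G.dist u w) → x * (2 * N) ≤ #(resolvers G.dist u w)) →
      (G.metricDim : ℝ) < 2 * Real.log N / x := by
    intro x h0 h1 hx
    refine SimpleGraph.metricDim_lt_of_resolvers (hbip.even_dist_iff hdr.1) hN4 ?_ hcard h0 h1 ?_
    · intro u
      convert hhalf u
    · intro u w huw he
      rw [hcardR]
      exact hx u w huw he
  rw [hcardR, hhalfdiv]
  constructor
  · have hs : (2 : ℝ) ≤ √N := Real.le_sqrt_of_sq_le (by linarith)
    have hsq : √N * √N = N := Real.mul_self_sqrt (by linarith)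
    have h4 : √(2 * (2 * N : ℝ)) = 2 * √N := by
      rw [show (2 * (2 * N) : ℝ) = 2 ^ 2 * N by ring, Real.sqrt_mul (by norm_num),
        Real.sqrt_sq (by norm_num)]
    -- The proportion is `√N` resolvers out of `2N` vertices.
    refine (hmetric (1 / (2 * √N)) (by positivity) ?_ ?_).trans_eq ?_
    · exact one_div_le_one_div_of_le two_pos (by linarith)
    · intro u w huw he
      have h5 := SimpleGraph.card_half_le_card_resolvers_sq hbip hdr hdiam
        (fun C => (hprim C).1) huw he
      have h6 : N ≤ #(resolvers G.dist u w) ^ 2 := by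
        rw [← hhalf u]
        convert h5
      have h7 : √N ≤ #(resolvers G.dist u w) :=
        Real.sqrt_le_iff.2 ⟨by positivity, by exact_mod_cast h6⟩
      refine le_trans (le_of_eq ?_) h7
      field_simp
      linarith
    · rw [h4]
      field_simp
  · have hNM : (0 : ℝ) < N - G.maxSphereCard := by linarith
    have hNM' : (0 : ℝ) < 2 * N - 2 * G.maxSphereCard := by linarith
    -- The proportion is `4 (N - M) / d` out of `2N`; it is at most `1 / 2` because `d ≥ 4`.
    refine (hmetric (2 * (N - G.maxSphereCard) / (G.diam * N)) (by positivity) ?_ ?_).trans_eq ?_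
    · rw [div_le_iff₀ (by positivity)]
      have h5 : (0 : ℝ) ≤ G.maxSphereCard := Nat.cast_nonneg _
      nlinarith
    · intro u w huw he
      have h5 := SimpleGraph.card_half_sub_le_diam_mul hbip hdr hdiam
        (fun C => (hprim C).1) huw he
      have h6 : 4 * (N - G.maxSphereCard) ≤ G.diam * #(resolvers G.dist u w) := by
        rw [← hhalf u]
        convert h5
      have h7 : 4 * ((N : ℝ) - G.maxSphereCard) ≤ G.diam * #(resolvers G.dist u w) := by
        rw [← Nat.cast_sub hM.le]
        exact_mod_cast h6
      rw [div_mul_eq_mul_div, div_le_iff₀ (by positivity)]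
      nlinarith
    · rw [show (2 * N - 2 * G.maxSphereCard : ℝ) = 2 * (N - G.maxSphereCard) by ring]
      field_simp
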